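/- Let $X$ be a nonempty finite or countably infinite set, let $\alpha=(\alpha_{xy})_{x,y\in X}$ be a matrix of nonnegative real numbers, and let $\Lambda\subseteq X$ be a finite subset. Notation. Matrices indexed by $X$ have entries in $[0,\infty]$, with $0\cdot\infty=0$, and are multiplied by $(AB)_{xy}=\sum_z A_{xz}B_{zy}$. For $f\colon X\to[0,\infty)$, $I_f$ is the diagonal matrix with entries $f(x)$, and $I_\Lambda=I_{\chi_\Lambda}$. We write $\operatorname{supp} f=\{x: f(x)\neq 0\}$. For $f\colon X\to[0,1]$ the cleaning operator is $\beta_f=I_{1-f}+I_f\alpha$. For a matrix of the form $I_\Lambda A I_\Lambda$, $\operatorname{spr}(I_\Lambda AI_\Lambda)$ is the spectral radius of the finite matrix $(A_{xy})_{x,y\in\Lambda}$ (it is $0$ if $\Lambda=\emptyset$, and $+\infty$ if some entry with $x,y\in\Lambda$ is infinite). Limits of matrices are entrywise. A marker is a nonempty finite sequence $\eta=(x_0,\dots,x_k)$ in $X$; its level is $k$, and its ancestors are the prefixes $(x_0,\dots,x_j)$, $0\le j\le k$; write $\sigma\preccurlyeq\eta$ if $\sigma$ is an ancestor of $\eta$.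 A cloud is a function $\nu$ from markers to $\mathbb R$. Put $\widetilde\nu(\eta)=\sum_{\sigma\preccurlyeq\eta}\nu(\sigma)$ and $|||\nu|||=\sup_\eta\sum_{\sigma\preccurlyeq\eta}|\nu(\sigma)|$. A cloud $\nu$ is carried by $\Lambda$ if $\nu((x_0,\dots,x_k))=0$ whenever $x_j\notin\Lambda$ for some $j<k$; it is supported on finitely many levels if for some $N$ it vanishes on all markers of level $>N$; it belongs to $\mathcal S_1$ if $\nu\ge0$ and $\sup_{\eta'\succcurlyeq\eta}\widetilde\nu(\eta')=1$ for every marker $\eta$. For a cloud $\nu\ge 0$, $$T_\nu=\sum_{\eta=(x_0,\dots,x_k)}\nu(\eta)\,I_{\{x_0\}}\alpha I_{\{x_1\}}\alpha\cdots\alpha I_{\{x_k\}}.$$ Then the following conditions are equivalent: (a) $\operatorname{spr}(I_\Lambda\alpha I_\Lambda)<1$. (b) For all $h\colon X\to[0,1]$ with $\operatorname{supp}h=\Lambda$, $\operatorname{spr}(I_\Lambda\beta_hI_\Lambda)<1$. (b$'$) There exists $h\colon X\to[0,1]$ with $\operatorname{supp}h\subseteq\Lambda$ such that $\operatorname{spr}(I_\Lambda\beta_hI_\Lambda)<1$.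 (c) For every finite sequence $f_1,\dots,f_m\colon X\to[0,1]$ with $\operatorname{supp}\bigl(\sum_{i=1}^m f_i\bigr)=\Lambda$, $\operatorname{spr}(I_\Lambda\beta_{f_1}\cdots\beta_{f_m}I_\Lambda)<1$. (c$'$) There exists a finite sequence $f_1,\dots,f_m\colon X\to[0,1]$ with $\operatorname{supp}(f_i)\subseteq\Lambda$ for all $i$ such that $\operatorname{spr}(I_\Lambda\beta_{f_1}\cdots\beta_{f_m}I_\Lambda)<1$. (d) For every cloud $\nu\ge0$ that is carried by $\Lambda$ and satisfies $|||\nu|||\le1$ and $\nu((x))<1$ for every $x\in\Lambda$, $\operatorname{spr}(I_\Lambda T_\nu I_\Lambda)<1$. (d$'$) There exists a cloud $\nu\in\mathcal S_1$ that is carried by $\Lambda$ and supported on finitely many levels such that $\operatorname{spr}(I_\Lambda T_\nu I_\Lambda)<1$. (e) For every infinite sequence $f_1,f_2,\dots\colon X\to[0,1]$ with $\operatorname{supp}(f_i)\subseteq\Lambda$ for all $i$ and $\sum_i f_i=\infty$ everywhere on $\Lambda$, $\lim_{n\to\infty}I_\Lambda\beta_{f_1}\cdots\beta_{f_n}I_\Lambda=0$.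 (f) For every infinite sequence $\nu_1,\nu_2,\dots$ of nonnegative clouds carried by $\Lambda$ and satisfying $|||\nu_i|||\le1$ and $\sum_i[1-\nu_i((x))]=\infty$ for all $x\in\Lambda$, $\lim_{n\to\infty}I_\Lambda T_{\nu_1}\cdots T_{\nu_n}I_\Lambda=0$. (In (c) and (c$'$) the sequence may be empty, the empty product being the identity matrix.) -/

import Mathlib

open Filter Topology
open scoped ENNReal NNReal

namespace Balayage

/-! ### Operators

An operator is a matrix indexed by `X` with entries in `[0, ∞]`; the convention `0 * ∞ = 0` is
the one of `ℝ≥0∞`.  Products are given by the usual (possibly infinite) sums. -/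

/-- Nonnegative matrices indexed by `X`, with entries in `[0, ∞]`. -/
abbrev Operator (X : Type*) := Matrix X X ℝ≥0∞

/-- The product `A B` of two operators. -/
noncomputable def mul {X : Type*} (A B : Operator X) : Operator X :=
  fun x y => ∑' z, A x z * B z y

open Classical in
/-- The operator `I_f` of multiplication by `f`. -/
noncomputable def mulBy {X : Type*} (f : X → ℝ≥0∞) : Operator X :=
  fun x y => if x = y then f x else 0

/-- The projection `I_Λ`, i.e. multiplication by the indicator function of `Λ`. -/
noncomputable def proj {X : Type*} (Λ : Set X) : Operator X :=
  mulBy (Λ.indicator 1)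

/-- The product `A₁ A₂ ⋯ A_n` of a finite list of operators (the identity for the empty list). -/
noncomputable def prod {X : Type*} : List (Operator X) → Operator X
  | [] => proj Set.univ
  | A :: l => mul A (prod l)

/-- The operator `I_Λ A I_Λ`. -/
noncomputable def sandwich {X : Type*} (Λ : Set X) (A : Operator X) : Operator X :=
  mul (mul (proj Λ) A) (proj Λ)

/-- A finite nonnegative matrix `α`, viewed as an operator. -/
noncomputable def toOp {X : Type*} (α : Matrix X X ℝ≥0) : Operator X :=
  fun x y => (α x y : ℝ≥0∞)

/-- The cleaning operator `β_f = I_{1-f} + I_f α`, for `f : X → [0,1]`. -/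
noncomputable def clean {X : Type*} (α : Matrix X X ℝ≥0) (f : X → unitInterval) : Operator X :=
  mulBy (fun x => ENNReal.ofReal (1 - (f x : ℝ))) +
    mul (mulBy (fun x => ENNReal.ofReal (f x : ℝ))) (toOp α)

open Classical in
/-- The spectral radius of an operator `A` that vanishes outside `Λ × Λ` with `Λ` finite, i.e.
the spectral radius (over `ℂ`) of the finite matrix `(A x y)` with `x, y ∈ Λ`; it is `∞` if one
of these entries is infinite. -/
noncomputable def spr {X : Type*} (Λ : Finset X) (A : Operator X) : ℝ≥0∞ :=
  if ∀ x ∈ Λ, ∀ y ∈ Λ, A x y ≠ ∞ then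
    spectralRadius ℂ (Matrix.of fun x y : Λ => (((A x y).toReal : ℝ) : ℂ))
  else ∞

/-! ### Markers and clouds -/

/-- A marker `(x₀, x₁, …, x_k)`, a nonempty finite sequence of elements of `X`:
`first = x₀` and `rest = [x₁, …, x_k]`. -/
structure Marker (X : Type*) where
  first : X
  rest : List X

namespace Marker

/-- The level `k` of the marker `(x₀, …, x_k)`. -/
def level {X : Type*} (η : Marker X) : ℕ := η.rest.length

/-- The marker `(x)` of level `0`. -/
def single {X : Type*} (x : X) : Marker X := ⟨x, []⟩

/-- The list `[x₀, …, x_k]` of entries of a marker. -/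
def entries {X : Type*} (η : Marker X) : List X := η.first :: η.rest

/-- The prefix `(x₀, …, x_j)` of the marker `(x₀, …, x_k)`, for `j ≤ k`. -/
def upTo {X : Type*} (η : Marker X) (j : ℕ) : Marker X := ⟨η.first, η.rest.take j⟩

/-- `σ` is an ancestor (prefix) of `η`. -/
def IsAncestor {X : Type*} (σ η : Marker X) : Prop := ∃ j ≤ η.level, σ = η.upTo j

end Marker

/-- A cloud is a real-valued function on the set of markers. -/
abbrev Cloud (X : Type*) := Marker X → ℝ

namespace Cloud

/-- The cumulative distribution: the sum of `ν` over the ancestors of `η`. -/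
noncomputable def cum {X : Type*} (ν : Cloud X) (η : Marker X) : ℝ :=
  ∑ j ∈ Finset.range (η.level + 1), ν (η.upTo j)

/-- The norm of a cloud: the supremum over `η` of the sum of `|ν|` over the ancestors of `η`. -/
noncomputable def norm {X : Type*} (ν : Cloud X) : ℝ≥0∞ :=
  ⨆ η : Marker X, ENNReal.ofReal (cum (fun σ => |ν σ|) η)

/-- For `ν ≥ 0`, the supremum `M_ν(η)` of the cumulative distribution over the markers that have
`η` as an ancestor. -/
noncomputable def branchSup {X : Type*} (ν : Cloud X) (η : Marker X) : ℝ≥0∞ :=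
  ⨆ η' : {η' : Marker X // η.IsAncestor η'}, ENNReal.ofReal (cum ν η'.1)

/-- The class `S_a` of clouds `ν ≥ 0` such that `M_ν(η) = a` for all markers `η`. -/
def MemS {X : Type*} (a : ℝ) (ν : Cloud X) : Prop :=
  (∀ η, 0 ≤ ν η) ∧ ∀ η, branchSup ν η = ENNReal.ofReal a

/-- `ν` is carried by `Λ`: it vanishes on all markers `(x₀, …, x_k)` that have an entry `x_j`
with `j < k` outside `Λ`. -/
def CarriedBy {X : Type*} (Λ : Set X) (ν : Cloud X) : Prop :=
  ∀ η : Marker X, (∃ x ∈ η.entries.dropLast, x ∉ Λ) → ν η = 0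

/-- `ν` is supported on finitely many levels. -/
def FiniteLevels {X : Type*} (ν : Cloud X) : Prop :=
  ∃ N : ℕ, ∀ η : Marker X, N < η.level → ν η = 0

end Cloud

/-- The operator `I_{x₀} α I_{x₁} α ⋯ α I_{x_k}`, as a function of `x₀` and `[x₁, …, x_k]`. -/
noncomputable def pathOp {X : Type*} (α : Matrix X X ℝ≥0) : X → List X → Operator X
  | x, [] => proj {x}
  | x, y :: l => mul (mul (proj {x}) (toOp α)) (pathOp α y l)

/-- The operator `T_ν = ∑_η ν(η) T_η` of a nonnegative cloud, with entries in `[0, ∞]`. -/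
noncomputable def cloudOp {X : Type*} (α : Matrix X X ℝ≥0) (ν : Cloud X) : Operator X :=
  fun x y => ∑' η : Marker X, ENNReal.ofReal (ν η) * pathOp α η.first η.rest x y

end Balayage

open Balayage

/-! Everything is compared with (a), by testing operators on functions. If (a) holds, the Neumann
series `v = ∑ (I_Λ α)ⁿ χ_Λ` is finite, vanishes off `Λ` and satisfies `α v + 1 ≤ v` on `Λ`. Both
kinds of operators inherit a quantitative form of this, `T v + d ≤ v`, with `d = f` for `β_f`
(`act_clean_add_le`) and `d = 1 - ν((x))` on `Λ` for `T_ν` (`act_cloudOp_add_le`). Strict decrease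
of `v` on `Λ` gives spectral radius below 1 by a maximum principle (`spr_lt_one_of_superharmonic`).
For infinite products the losses `d` telescope, and with the lower bound `1 - d` on the diagonal
they force the entries to 0 (`tendsto_sandwich_prod_zero`).

If (a) fails, the modulus of an eigenvector, extended by zero, is a nonzero `u ≤ α u`. Then `u ≤ T
u` for every `β_f` and for every `T_ν` with `ν ∈ S_1` of finitely many levels (`le_act_clean`,
`le_act_cloudOp`), hence for their products. This excludes both spectral radius below 1 and
convergence of the products to 0.

The existential conditions, and the test sequences for (e) and (f), come from the indicator of `Λ`
and from `stepCloud`, whose operator is the cleaning operator of that indicator. -/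

namespace Balayage

/-! ### Complex matrices -/

section ComplexMatrix

variable {ι : Type*} [Fintype ι] [DecidableEq ι]

attribute [local instance] Matrix.linftyOpNormedRing Matrix.linftyOpNormedAlgebra

/-- Gelfand's formula: for `r` between the spectral radius and 1, eventually `‖C ^ n‖ ≤ r ^ n`. -/
theorem summable_norm_pow_of_spectralRadius_lt_one {C : Matrix ι ι ℂ}
    (h : spectralRadius ℂ C < 1) : Summable fun n => ‖C ^ n‖ := by
  have : CompleteSpace (Matrix ι ι ℂ) := FiniteDimensional.complete ℂ _
  obtain ⟨r, hr, hr1⟩ := ENNReal.lt_iff_exists_nnreal_btwn.1 h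
  have hr1 : r < 1 := by exact_mod_cast hr1
  have hev := (spectrum.pow_nnnorm_pow_one_div_tendsto_nhds_spectralRadius C).eventually
    (gt_mem_nhds hr)
  refine Summable.of_norm_bounded_eventually_nat (g := fun n => (r : ℝ) ^ n)
    (summable_geometric_of_lt_one r.2 (by exact_mod_cast hr1)) ?_
  filter_upwards [hev, eventually_gt_atTop 0] with n hn hn0
  have hn0' : (0 : ℝ) < n := by exact_mod_cast hn0
  have h1 := ENNReal.rpow_le_rpow hn.le hn0'.le
  rw [← ENNReal.rpow_mul, one_div, inv_mul_cancel₀ hn0'.ne', ENNReal.rpow_one,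
    ENNReal.rpow_natCast] at h1
  rw [norm_norm]
  exact_mod_cast h1

theorem summable_norm_iterate_of_spectralRadius_lt_one {C : Matrix ι ι ℂ}
    (h : spectralRadius ℂ C < 1) {w : ℕ → ι → ℂ} (hw : ∀ n, w (n + 1) = C.mulVec (w n)) (i : ι) :
    Summable fun n => ‖w n i‖ := by
  have hpow : ∀ n, w n = (C ^ n).mulVec (w 0) := by
    intro n
    induction n with
    | zero => simp
    | succ n ih => rw [hw, ih, Matrix.mulVec_mulVec, pow_succ']
  refine Summable.of_nonneg_of_le (fun n => norm_nonneg _) (fun n => ?_)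
    ((summable_norm_pow_of_spectralRadius_lt_one h).mul_right ‖w 0‖)
  calc ‖w n i‖ ≤ ‖w n‖ := norm_le_pi_norm _ _
    _ ≤ ‖C ^ n‖ * ‖w 0‖ := by rw [hpow n]; exact Matrix.linfty_opNorm_mulVec _ _

/-- The spectrum is compact and, in finite dimension, consists of eigenvalues. An empty spectrum has
radius 0, which the hypothesis excludes. -/
theorem exists_eigenvector_of_one_le_spectralRadius {C : Matrix ι ι ℂ}
    (h : ¬ spectralRadius ℂ C < 1) :
    ∃ (k : ℂ) (z : ι → ℂ), 1 ≤ ‖k‖ ∧ z ≠ 0 ∧ C.mulVec z = k • z := by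
  have : CompleteSpace (Matrix ι ι ℂ) := FiniteDimensional.complete ℂ _
  have hne : (spectrum ℂ C).Nonempty := by
    by_contra hne
    rw [Set.not_nonempty_iff_eq_empty] at hne
    exact h (by simp [spectralRadius, hne])
  have : ∃ k ∈ spectrum ℂ C, 1 ≤ ‖k‖ := by
    by_contra! hk
    exact h (by exact_mod_cast
      spectrum.spectralRadius_lt_of_forall_lt_of_nonempty hne (r := 1) fun k hk' => hk k hk')
  obtain ⟨k, hk, hk1⟩ := this
  rw [← Matrix.spectrum_toLin', ← Module.End.hasEigenvalue_iff_mem_spectrum] at hk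
  obtain ⟨z, hz⟩ := hk.exists_hasEigenvector
  exact ⟨k, z, hk1, hz.2, by simpa using hz.apply_eq_smul⟩

end ComplexMatrix

/-! ### Operators acting on functions -/

section Act

variable {X : Type*}

/-- The function `A u`. -/
noncomputable def act (A : Operator X) (u : X → ℝ≥0∞) : X → ℝ≥0∞ := fun x => ∑' y, A x y * u y

theorem act_mono (A : Operator X) {u v : X → ℝ≥0∞} (h : u ≤ v) : act A u ≤ act A v :=
  fun _ => ENNReal.tsum_le_tsum fun y => by gcongr; exact h y

theorem act_mul (A B : Operator X) (u : X → ℝ≥0∞) : act (mul A B) u = act A (act B u) := by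
  funext x
  simp only [act, mul, ← ENNReal.tsum_mul_left, ← ENNReal.tsum_mul_right]
  rw [ENNReal.tsum_comm]
  simp only [mul_assoc]

theorem act_add (A B : Operator X) (u : X → ℝ≥0∞) : act (A + B) u = act A u + act B u := by
  funext x
  simp only [act, Matrix.add_apply, Pi.add_apply, add_mul, ENNReal.tsum_add]

theorem act_add_right (A : Operator X) (u v : X → ℝ≥0∞) :
    act A (u + v) = act A u + act A v := by
  funext x
  simp only [act, Pi.add_apply, mul_add, ENNReal.tsum_add]

theorem act_mulBy (f u : X → ℝ≥0∞) (x : X) : act (mulBy f) u x = f x * u x := by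
  rw [act, tsum_eq_single x fun y hy => by simp [mulBy, hy.symm]]
  simp [mulBy]

theorem act_univ (u : X → ℝ≥0∞) : act (proj Set.univ) u = u := by
  funext x
  rw [proj, act_mulBy]
  simp

theorem act_prod_append (l : List (Operator X)) (B : Operator X) (u : X → ℝ≥0∞) :
    act (prod (l ++ [B])) u = act (prod l) (act B u) := by
  induction l with
  | nil => simp [prod, act_mul, act_univ]
  | cons A l ih => simp [prod, act_mul, ih]

theorem act_single [DecidableEq X] (A : Operator X) (x y : X) :
    act A (Pi.single y 1) x = A x y := by
  rw [act, tsum_eq_single y fun z hz => by simp [hz]]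
  simp

theorem le_act (A : Operator X) (u : X → ℝ≥0∞) (x y : X) : A x y * u y ≤ act A u x :=
  ENNReal.le_tsum y

theorem act_toOp_apply (α : Matrix X X ℝ≥0) (u : X → ℝ≥0∞) (x : X) :
    act (toOp α) u x = ∑' y, (α x y : ℝ≥0∞) * u y := rfl

theorem act_eq_sum {Λ : Finset X} {u : X → ℝ≥0∞} (hu : ∀ x ∉ Λ, u x = 0) (A : Operator X)
    (x : X) : act A u x = ∑ y : Λ, A x y * u y := by
  rw [act, tsum_eq_sum (s := Λ) fun y hy => by rw [hu y hy, mul_zero]]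
  exact (Finset.sum_coe_sort Λ fun y => A x y * u y).symm

theorem sandwich_apply_of_mem {Λ : Set X} (A : Operator X) {x y : X} (hx : x ∈ Λ) (hy : y ∈ Λ) :
    sandwich Λ A x y = A x y := by
  rw [sandwich, mul, tsum_eq_single y fun z hz => by simp [proj, mulBy, hz]]
  rw [mul, tsum_eq_single x fun z hz => by simp [proj, mulBy, hz.symm]]
  simp [proj, mulBy, hx, hy]

theorem sandwich_apply_eq_zero {Λ : Set X} (A : Operator X) {x y : X} (h : x ∉ Λ ∨ y ∉ Λ) :
    sandwich Λ A x y = 0 := by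
  rcases h with h | h
  · simp only [sandwich, mul, ENNReal.tsum_eq_zero, mul_eq_zero]
    refine fun z => Or.inl fun w => ?_
    by_cases hxw : x = w <;> simp [proj, mulBy, hxw]
    left; subst hxw; exact h
  · simp only [sandwich, mul, ENNReal.tsum_eq_zero, mul_eq_zero]
    refine fun z => Or.inr ?_
    by_cases hzy : z = y <;> simp [proj, mulBy, hzy]
    exact h

theorem spr_sandwich (Λ : Finset X) (A : Operator X) : spr Λ (sandwich Λ A) = spr Λ A := by
  have h : ∀ x ∈ Λ, ∀ y ∈ Λ, sandwich Λ A x y = A x y :=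
    fun x hx y hy => sandwich_apply_of_mem A (by simpa using hx) (by simpa using hy)
  have h2 : (fun x y : Λ => (((sandwich Λ A x y).toReal : ℝ) : ℂ)) =
      fun x y : Λ => (((A x y).toReal : ℝ) : ℂ) := by
    funext x y
    rw [h x x.2 y y.2]
  unfold spr
  rw [h2]
  congr 1
  exact propext ⟨fun H x hx y hy => h x hx y hy ▸ H x hx y hy,
    fun H x hx y hy => (h x hx y hy).symm ▸ H x hx y hy⟩

/-! ### Spectral radius and strictly superharmonic functions -/

/-- A spectral radius less than one yields a finite `v = 1 + A v` on `Λ`. -/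
theorem exists_superharmonic_of_spr_lt_one {Λ : Finset X} {A : Operator X} (h : spr Λ A < 1) :
    ∃ v : X → ℝ≥0∞, (∀ x ∉ Λ, v x = 0) ∧ (∀ x, v x ≠ ∞) ∧ (∀ x ∈ Λ, 1 ≤ v x) ∧
      ∀ x ∈ Λ, act A v x + 1 ≤ v x := by
  classical
  unfold spr at h
  split_ifs at h with hfin
  swap
  · simp at h
  -- `W n = (I_Λ A)ⁿ χ_Λ`, the terms of the Neumann series whose sum is `v`.
  let W : ℕ → X → ℝ≥0∞ := fun n =>
    Nat.rec (fun x => if x ∈ Λ then 1 else 0) (fun _ u x => if x ∈ Λ then act A u x else 0) n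
  have hWs : ∀ n x, W (n + 1) x = if x ∈ Λ then act A (W n) x else 0 := fun n x => rfl
  have hW0 : ∀ x, W 0 x = if x ∈ Λ then 1 else 0 := fun x => rfl
  have hWout : ∀ n, ∀ x ∉ Λ, W n x = 0 := by
    intro n x hx
    cases n with
    | zero => simp [hW0, hx]
    | succ n => simp [hWs, hx]
  have hWfin : ∀ n x, W n x ≠ ∞ := by
    intro n
    induction n with
    | zero => intro x; rw [hW0]; split_ifs <;> simp
    | succ n ih =>
      intro x
      rw [hWs]
      split_ifs with hx
      · rw [act_eq_sum (hWout n)]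
        exact ENNReal.sum_ne_top.2 fun y _ => ENNReal.mul_ne_top (hfin x hx y y.2) (ih y)
      · simp
  let w : ℕ → Λ → ℂ := fun n x => (((W n x).toReal : ℝ) : ℂ)
  have hw : ∀ n, w (n + 1) =
      (Matrix.of fun x y : Λ => (((A x y).toReal : ℝ) : ℂ)).mulVec (w n) := by
    intro n
    funext x
    simp only [w, hWs, x.2, if_true, Matrix.mulVec, dotProduct, Matrix.of_apply]
    rw [act_eq_sum (hWout n), ENNReal.toReal_sum fun (y : Λ) _ =>
      ENNReal.mul_ne_top (hfin x x.2 y y.2) (hWfin n y)]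
    simp
  have hsum : ∀ x : Λ, Summable fun n => (W n x).toReal := by
    intro x
    refine (summable_norm_iterate_of_spectralRadius_lt_one h hw x).congr fun n => ?_
    simp [w]
  refine ⟨fun x => ∑' n, W n x, fun x hx => ?_, fun x => ?_, fun x hx => ?_, fun x hx => ?_⟩
  · simp [hWout _ x hx]
  · by_cases hx : x ∈ Λ
    · have := (hsum ⟨x, hx⟩).tsum_ofReal_ne_top
      simpa [ENNReal.ofReal_toReal (hWfin _ x)] using this
    · simp [hWout _ x hx]
  · calc (1 : ℝ≥0∞) = W 0 x := by simp [hW0, hx]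
      _ ≤ _ := ENNReal.le_tsum 0
  -- Splitting off the term `n = 0` gives `v = 1 + A v` on `Λ`.
  · refine le_of_eq ?_
    dsimp only
    rw [tsum_eq_zero_add' ENNReal.summable]
    simp only [hW0, hWs, hx, if_true]
    rw [add_comm, act]
    simp only [act, ← ENNReal.tsum_mul_left]
    rw [ENNReal.tsum_comm]

/-- A spectral radius at least one yields a nonzero `u ≤ A u` on `Λ`. -/
theorem exists_subharmonic_of_one_le_spr {Λ : Finset X} {A : Operator X}
    (hfin : ∀ x ∈ Λ, ∀ y ∈ Λ, A x y ≠ ∞) (h : ¬ spr Λ A < 1) :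
    ∃ u : X → ℝ≥0∞, (∀ x ∉ Λ, u x = 0) ∧ (∀ x, u x ≠ ∞) ∧ (∃ x ∈ Λ, u x ≠ 0) ∧
      u ≤ act A u := by
  classical
  unfold spr at h
  rw [if_pos hfin] at h
  obtain ⟨k, z, hk, hz, hzk⟩ := exists_eigenvector_of_one_le_spectralRadius h
  -- No Perron-Frobenius theory is needed: the triangle inequality applied to `k z = A z` gives `|z|
  -- ≤ |k| |z| ≤ A |z|`.
  let u : X → ℝ≥0∞ := fun x => if hx : x ∈ Λ then ‖z ⟨x, hx⟩‖ₑ else 0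
  have hu : ∀ x : Λ, u x = ‖z x‖ₑ := fun x => by simp [u]
  have hout : ∀ x ∉ Λ, u x = 0 := fun x hx => by simp [u, hx]
  refine ⟨u, hout, fun x => ?_, ?_, fun x => ?_⟩
  · by_cases hx : x ∈ Λ <;> simp [u, hx]
  · obtain ⟨x, hx⟩ := Function.ne_iff.1 hz
    exact ⟨x, x.2, by rw [hu]; simpa using hx⟩
  · by_cases hx : x ∈ Λ
    swap
    · simp [hout x hx]
    rw [act_eq_sum hout]
    have h1 := congrFun hzk ⟨x, hx⟩
    simp only [Matrix.mulVec, dotProduct, Matrix.of_apply, Pi.smul_apply, smul_eq_mul] at h1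
    have hk' : (1 : ℝ≥0∞) ≤ ‖k‖ₑ := by
      rw [← ofReal_norm]
      exact ENNReal.one_le_ofReal.2 hk
    calc u x = 1 * ‖z ⟨x, hx⟩‖ₑ := by rw [one_mul]; exact hu ⟨x, hx⟩
      _ ≤ ‖k‖ₑ * ‖z ⟨x, hx⟩‖ₑ := by gcongr
      _ = ‖∑ y : Λ, (((A x y).toReal : ℝ) : ℂ) * z y‖ₑ := by rw [h1, enorm_mul]
      _ ≤ ∑ y : Λ, ‖(((A x y).toReal : ℝ) : ℂ) * z y‖ₑ := enorm_sum_le _ _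
      _ = ∑ y : Λ, A x y * u y := by
        refine Finset.sum_congr rfl fun y _ => ?_
        rw [enorm_mul, hu, ← ofReal_norm, Complex.norm_real, Real.norm_eq_abs,
          ENNReal.abs_toReal, ENNReal.ofReal_toReal (hfin x hx y y.2)]

/-- Maximum principle: let `t = u / v` be maximal at `a ∈ Λ`, so that `u ≤ t v`. If `t ≠ 0`, then `u
a ≤ A u a ≤ t (A v a) < t (v a) = u a`. -/
theorem eq_zero_of_subharmonic {Λ : Finset X} {A : Operator X} {u v : X → ℝ≥0∞}
    (hv : ∀ x, v x ≠ ∞) (hvA : ∀ x ∈ Λ, act A v x < v x) (hu : ∀ x, u x ≠ ∞)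
    (huΛ : ∀ x ∉ Λ, u x = 0) (huA : ∀ x ∈ Λ, u x ≤ act A u x) (x : X) (hx : x ∈ Λ) : u x = 0 := by
  obtain ⟨a, ha, hmax⟩ := Λ.exists_max_image (fun x => u x / v x) ⟨x, hx⟩
  have hv0 : ∀ x ∈ Λ, v x ≠ 0 := fun x hx => (pos_of_gt (hvA x hx)).ne'
  set t := u a / v a with ht
  have hle : ∀ y, u y ≤ t * v y := by
    intro y
    by_cases hy : y ∈ Λ
    · exact (ENNReal.div_le_iff (hv0 y hy) (hv y)).1 (hmax y hy)
    · simp [huΛ y hy]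
  by_contra hux
  have ht0 : t ≠ 0 := by
    intro h0
    have := hle x
    rw [h0, zero_mul] at this
    exact hux (le_antisymm this zero_le)
  have htop : t ≠ ∞ := ENNReal.div_ne_top (hu a) (hv0 a ha)
  have h1 : t * v a = u a := ENNReal.div_mul_cancel (hv0 a ha) (hv a)
  have h2 : act A u a ≤ t * act A v a := by
    simp only [act, ← ENNReal.tsum_mul_left]
    refine ENNReal.tsum_le_tsum fun y => ?_
    calc A a y * u y ≤ A a y * (t * v y) := by gcongr; exact hle y
      _ = t * (A a y * v y) := by ring
  have h3 : t * act A v a < t * v a := ENNReal.mul_lt_mul_right ht0 htop (hvA a ha)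
  exact absurd ((huA a ha).trans h2) (not_le.2 (h1 ▸ h3))

theorem spr_lt_one_of_superharmonic {Λ : Finset X} {A : Operator X} {v : X → ℝ≥0∞}
    (hv : ∀ x, v x ≠ ∞) (hvA : ∀ x ∈ Λ, act A v x < v x) : spr Λ A < 1 := by
  by_contra h
  -- The entries on `Λ` are finite, since `A x y * v y ≤ A v x < v x` while `v y > 0`.
  obtain ⟨u, huΛ, hu, ⟨x, hx, hx0⟩, huA⟩ := exists_subharmonic_of_one_le_spr (fun x hx y hy => by
    intro htop
    have := ((le_act A v x y).trans_lt (hvA x hx)).ne_top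
    rw [htop, ENNReal.top_mul (pos_of_gt (hvA y hy)).ne'] at this
    exact this rfl) h
  exact hx0 (eq_zero_of_subharmonic hv hvA hu huΛ (fun x _ => huA x) x hx)

/-- If every nonnegative `u ≤ α u` on `Λ` satisfies `u ≤ T u` then `spr T < 1` gives `spr α < 1`. -/
theorem spr_toOp_lt_one_of_spr_lt_one {Λ : Finset X} {α : Matrix X X ℝ≥0} {T : Operator X}
    (hT : ∀ u : X → ℝ≥0∞, (∀ x ∉ Λ, u x = 0) → u ≤ act (toOp α) u → u ≤ act T u)
    (h : spr Λ T < 1) : spr Λ (toOp α) < 1 := by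
  by_contra hα
  obtain ⟨u, huΛ, hu, ⟨x, hx, hx0⟩, huA⟩ :=
    exists_subharmonic_of_one_le_spr (fun x _ y _ => ENNReal.coe_ne_top) hα
  obtain ⟨v, -, hv, hv1, hvT⟩ := exists_superharmonic_of_spr_lt_one h
  refine hx0 (eq_zero_of_subharmonic hv (fun x hx => ?_) hu huΛ (fun x _ => hT u huΛ huA x) x hx)
  have := hvT x hx
  refine lt_of_lt_of_le (ENNReal.lt_add_right ?_ one_ne_zero) this
  exact (le_self_add.trans this |>.trans_lt (hv x).lt_top).ne

theorem le_act_prod {u : X → ℝ≥0∞} {l : List (Operator X)} (h : ∀ T ∈ l, u ≤ act T u) :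
    u ≤ act (prod l) u := by
  induction l with
  | nil => simp [prod, act_univ]
  | cons A l ih =>
    rw [prod, act_mul]
    exact (h A (by simp)).trans (act_mono A (ih fun T hT => h T (by simp [hT])))

/-- If every nonnegative `u ≤ α u` on `Λ` satisfies `u ≤ T_i u` for all `i`, and `T₁ ⋯ T_n → 0`
on `Λ`, then `spr α < 1`. -/
theorem spr_toOp_lt_one_of_tendsto {Λ : Finset X} {α : Matrix X X ℝ≥0} {T : ℕ → Operator X}
    (hT : ∀ i, ∀ u : X → ℝ≥0∞, (∀ x ∉ Λ, u x = 0) → u ≤ act (toOp α) u → u ≤ act (T i) u)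
    (h : Tendsto (fun n => sandwich Λ (prod ((List.range n).map T))) atTop (𝓝 0)) :
    spr Λ (toOp α) < 1 := by
  by_contra hα
  obtain ⟨u, huΛ, hu, ⟨x, hx, hx0⟩, huA⟩ :=
    exists_subharmonic_of_one_le_spr (fun x _ y _ => ENNReal.coe_ne_top) hα
  -- The bound `u ≤ P_n u` persists for all `n`; in the limit it would give `u x ≤ 0`.
  have h1 : ∀ n, u x ≤ ∑ y : Λ, sandwich Λ (prod ((List.range n).map T)) x y * u y := by
    intro n
    have h2 : u ≤ act (prod ((List.range n).map T)) u := le_act_prod fun S hS => by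
      obtain ⟨i, -, rfl⟩ := List.mem_map.1 hS
      exact hT i u huΛ huA
    refine (h2 x).trans (le_of_eq ?_)
    rw [act_eq_sum huΛ]
    refine Finset.sum_congr rfl fun y _ => ?_
    rw [sandwich_apply_of_mem _ (by simpa using hx) (by simp)]
  have h2 : Tendsto (fun n => ∑ y : Λ, sandwich Λ (prod ((List.range n).map T)) x y * u y)
      atTop (𝓝 (∑ y : Λ, 0 * u y)) := by
    refine tendsto_finsetSum _ fun y _ => ENNReal.Tendsto.mul_const ?_ (Or.inr (hu y))
    exact tendsto_pi_nhds.1 (tendsto_pi_nhds.1 h x) y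
  have h3 := ge_of_tendsto' h2 h1
  simp only [zero_mul, Finset.sum_const_zero] at h3
  exact hx0 (le_antisymm h3 zero_le)

end Act

/-! ### Infinite products -/

/-- The quantity `∑_{k<n} p_k d_k + p_n` is nondecreasing by `hstep` and bounded, and the series in
it converges, so `p` has a limit `L`. If `L > 0`, then `d_k ≤ (2 / L) p_k d_k` eventually, and `∑
d_k` would converge. -/
theorem tendsto_zero_of_almost_monotone {p d : ℕ → ℝ} {V : ℝ} (hp : ∀ n, 0 ≤ p n)
    (hd : ∀ n, 0 ≤ d n) (hstep : ∀ n, p n * (1 - d n) ≤ p (n + 1))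
    (hbd : ∀ n, ∑ k ∈ Finset.range n, p k * d k + p n ≤ V)
    (hdiv : Tendsto (fun n => ∑ k ∈ Finset.range n, d k) atTop atTop) :
    Tendsto p atTop (𝓝 0) := by
  have hs : Summable fun k => p k * d k :=
    summable_of_sum_range_le (fun k => mul_nonneg (hp k) (hd k))
      fun n => (le_add_of_nonneg_right (hp n)).trans (hbd n)
  have hmono : Monotone fun n => ∑ k ∈ Finset.range n, p k * d k + p n := by
    refine monotone_nat_of_le_succ fun n => ?_
    rw [Finset.sum_range_succ]
    linarith [hstep n]
  have hconv := tendsto_atTop_ciSup hmono ⟨V, by rintro _ ⟨n, rfl⟩; exact hbd n⟩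
  obtain ⟨L, hL⟩ : ∃ L, Tendsto p atTop (𝓝 L) :=
    ⟨_, (hconv.sub hs.hasSum.tendsto_sum_nat).congr fun n => by ring⟩
  have hL0 : 0 ≤ L := ge_of_tendsto' hL hp
  rcases hL0.eq_or_lt with h0 | hpos
  · rwa [← h0] at hL
  exfalso
  obtain ⟨N, hN⟩ := eventually_atTop.1 (hL.eventually (lt_mem_nhds (half_lt_self hpos)))
  have hsd : Summable d := by
    have : Summable fun k => d (k + N) := by
      refine Summable.of_nonneg_of_le (fun k => hd _) (fun k => ?_)
        (((summable_nat_add_iff N).2 hs).mul_left (2 / L))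
      have h1 := hN (k + N) (by omega)
      have h2 := mul_le_mul_of_nonneg_right h1.le (hd (k + N))
      calc d (k + N) = 2 / L * (L / 2 * d (k + N)) := by field_simp
        _ ≤ _ := by gcongr
    exact (summable_nat_add_iff N).1 this
  exact not_tendsto_nhds_of_tendsto_atTop hdiv _ hsd.hasSum.tendsto_sum_nat

section

variable {X : Type*}

/-- Products of operators `T_i` with `T_i v + d_i ≤ v` on `Λ` and diagonal at least `1 - d_i`
converge to zero. -/
theorem tendsto_sandwich_prod_zero {Λ : Finset X} {T : ℕ → Operator X} {v : X → ℝ≥0∞}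
    {d : ℕ → X → ℝ} (hv : ∀ x, v x ≠ ∞) (hv1 : ∀ x ∈ Λ, 1 ≤ v x)
    (hd : ∀ i, ∀ x, 0 ≤ d i x) (hd1 : ∀ i, ∀ x ∈ Λ, d i x ≤ 1)
    (hT : ∀ i x, act (T i) v x + ENNReal.ofReal (d i x) ≤ v x)
    (hdiag : ∀ i, ∀ x ∈ Λ, ENNReal.ofReal (1 - d i x) ≤ T i x x)
    (hdiv : ∀ x ∈ Λ, Tendsto (fun n => ∑ i ∈ Finset.range n, d i x) atTop atTop) :
    Tendsto (fun n => sandwich Λ (prod ((List.range n).map T))) atTop (𝓝 0) := by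
  classical
  set P : ℕ → Operator X := fun n => prod ((List.range n).map T) with hP
  have hPs : ∀ n u, act (P (n + 1)) u = act (P n) (act (T n) u) := fun n u => by
    simp only [hP, List.range_succ, List.map_append, List.map_cons, List.map_nil,
      act_prod_append]
  refine tendsto_pi_nhds.2 fun x => tendsto_pi_nhds.2 fun y => ?_
  by_cases hxy : x ∉ (Λ : Set X) ∨ y ∉ (Λ : Set X)
  · simp only [sandwich_apply_eq_zero _ hxy]
    exact tendsto_const_nhds
  push Not at hxy
  obtain ⟨hx, hy⟩ := hxy
  have hy' : y ∈ Λ := by simpa using hy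
  simp only [sandwich_apply_of_mem _ hx hy]
  change Tendsto (fun n => P n x y) atTop (𝓝 0)
  -- Telescoping: applying `P n` to `T_n v + d_n ≤ v` shows that `P_n v` drops by at least `P_n
  -- d_n`, of which only the term at `y` is kept.
  have hsum : ∀ n, ∑ k ∈ Finset.range n, P k x y * ENNReal.ofReal (d k y) + act (P n) v x
      ≤ v x := by
    intro n
    induction n with
    | zero => simp [hP, prod, act_univ]
    | succ n ih =>
      refine le_trans ?_ ih
      rw [Finset.sum_range_succ, add_assoc]
      gcongr
      rw [hPs, add_comm]
      calc act (P n) (act (T n) v) x + P n x y * ENNReal.ofReal (d n y)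
          ≤ act (P n) (act (T n) v) x + act (P n) (fun x => ENNReal.ofReal (d n x)) x := by
            gcongr
            exact le_act _ (fun x => ENNReal.ofReal (d n x)) x y
        _ = act (P n) (act (T n) v + fun x => ENNReal.ofReal (d n x)) x := by
            rw [act_add_right]; rfl
        _ ≤ act (P n) v x := act_mono _ (fun z => hT n z) x
  have hPle : ∀ n, P n x y ≤ act (P n) v x := fun n =>
    (le_mul_of_one_le_right zero_le (hv1 y hy')).trans (le_act _ _ x y)
  have hPtop : ∀ n, P n x y ≠ ∞ := fun n =>
    ((hPle n).trans ((le_add_self).trans (hsum n)) |>.trans_lt (hv x).lt_top).ne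
  have hreal : Tendsto (fun n => (P n x y).toReal) atTop (𝓝 0) := by
    refine tendsto_zero_of_almost_monotone (d := fun n => d n y) (V := (v x).toReal)
      (fun n => ENNReal.toReal_nonneg) (fun n => hd n y) (fun n => ?_) (fun n => ?_) (hdiv y hy')
    -- In `P (n + 1) = P n T_n`, only the contribution of the diagonal entry `T_n y y` is kept.
    · have h1 : P n x y * ENNReal.ofReal (1 - d n y) ≤ P (n + 1) x y := by
        rw [← act_single (P (n + 1)), hPs]
        refine le_trans ?_ (le_act _ _ x y)
        rw [act_single]
        gcongr
        exact hdiag n y hy'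
      have h2 := ENNReal.toReal_mono (hPtop _) h1
      rwa [ENNReal.toReal_mul, ENNReal.toReal_ofReal (by linarith [hd1 n y hy'])] at h2
    · have h1 : ∑ k ∈ Finset.range n, P k x y * ENNReal.ofReal (d k y) + P n x y ≤ v x :=
        le_trans (by gcongr; exact hPle n) (hsum n)
      have h2 := ENNReal.toReal_mono (hv x) h1
      have h3 : ∀ k ∈ Finset.range n, P k x y * ENNReal.ofReal (d k y) ≠ ∞ :=
        fun k _ => ENNReal.mul_ne_top (hPtop k) ENNReal.ofReal_ne_top
      rw [ENNReal.toReal_add (ENNReal.sum_ne_top.2 h3) (hPtop n), ENNReal.toReal_sum h3] at h2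
      simpa [ENNReal.toReal_mul, ENNReal.toReal_ofReal, hd] using h2
  have := ENNReal.tendsto_ofReal hreal
  simpa [ENNReal.ofReal_toReal, hPtop] using this

/-! ### Cleaning operators -/

theorem act_clean (α : Matrix X X ℝ≥0) (f : X → unitInterval) (u : X → ℝ≥0∞) (x : X) :
    act (clean α f) u x =
      ENNReal.ofReal (1 - f x) * u x + ENNReal.ofReal (f x) * act (toOp α) u x := by
  rw [clean, act_add, Pi.add_apply, act_mulBy, act_mul, act_mulBy]

theorem ofReal_one_sub_add_ofReal (t : unitInterval) :
    ENNReal.ofReal (1 - (t : ℝ)) + ENNReal.ofReal t = 1 := by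
  rw [← ENNReal.ofReal_add (by linarith [t.2.2]) t.2.1]
  simp

theorem le_act_clean {α : Matrix X X ℝ≥0} (f : X → unitInterval) {u : X → ℝ≥0∞}
    (h : u ≤ act (toOp α) u) : u ≤ act (clean α f) u := by
  intro x
  rw [act_clean]
  calc u x = ENNReal.ofReal (1 - f x) * u x + ENNReal.ofReal (f x) * u x := by
        rw [← add_mul, ofReal_one_sub_add_ofReal, one_mul]
    _ ≤ _ := by gcongr; exact h x

/-- `β_f v` is a convex combination of `v` and `α v` with weight `f` on the latter, which is lower
by at least 1 on `Λ`; off `Λ` the weight is zero. -/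
theorem act_clean_add_le {Λ : Finset X} {α : Matrix X X ℝ≥0} {f : X → unitInterval}
    (hf : Function.support f ⊆ Λ) {v : X → ℝ≥0∞} (hv : ∀ x ∈ Λ, act (toOp α) v x + 1 ≤ v x)
    (x : X) : act (clean α f) v x + ENNReal.ofReal (f x) ≤ v x := by
  rw [act_clean]
  by_cases hx : x ∈ Λ
  · calc _ = ENNReal.ofReal (1 - f x) * v x +
          ENNReal.ofReal (f x) * (act (toOp α) v x + 1) := by ring
      _ ≤ ENNReal.ofReal (1 - f x) * v x + ENNReal.ofReal (f x) * v x := by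
          gcongr; exact hv x hx
      _ = v x := by rw [← add_mul, ofReal_one_sub_add_ofReal, one_mul]
  · have : f x = 0 := by
      by_contra h
      exact hx (by simpa using hf h)
    simp [this]

theorem ofReal_one_sub_le_clean (α : Matrix X X ℝ≥0) (f : X → unitInterval) (x : X) :
    ENNReal.ofReal (1 - f x) ≤ clean α f x x := by
  rw [clean, Matrix.add_apply]
  refine le_trans (le_of_eq ?_) le_self_add
  simp [mulBy]

theorem act_prod_clean_lt {Λ : Finset X} {α : Matrix X X ℝ≥0} {v : X → ℝ≥0∞}
    (hvt : ∀ x, v x ≠ ∞) (hv : ∀ x ∈ Λ, act (toOp α) v x + 1 ≤ v x)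
    {l : List (X → unitInterval)} (hl : ∀ f ∈ l, Function.support f ⊆ Λ) :
    act (prod (l.map (clean α))) v ≤ v ∧
      ∀ x, (∃ f ∈ l, f x ≠ 0) → act (prod (l.map (clean α))) v x < v x := by
  induction l with
  | nil => simp [prod, act_univ]
  | cons f l ih =>
    obtain ⟨ih1, ih2⟩ := ih fun g hg => hl g (by simp [hg])
    have hf := act_clean_add_le (hl f (by simp)) hv
    have hle : act (prod ((f :: l).map (clean α))) v ≤ act (clean α f) v := by
      rw [List.map_cons, prod, act_mul]
      exact act_mono _ ih1
    refine ⟨hle.trans fun x => le_self_add.trans (hf x), fun x hx => ?_⟩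
    -- If `f x = 0`, row `x` of `β_f` is that of the identity, so strict decrease at `x` is
    -- inherited from the remaining factors. Otherwise `β_f` itself causes it.
    by_cases hfx : f x = 0
    · rw [List.map_cons, prod, act_mul, act_clean]
      simp only [hfx, Set.Icc.coe_zero, sub_zero, ENNReal.ofReal_one, one_mul, ENNReal.ofReal_zero,
        zero_mul, add_zero]
      refine ih2 x ?_
      obtain ⟨g, hg, hgx⟩ := hx
      rcases List.mem_cons.1 hg with rfl | hg
      · exact absurd hfx hgx
      · exact ⟨g, hg, hgx⟩
    · refine lt_of_le_of_lt (hle x) (lt_of_lt_of_le (ENNReal.lt_add_right ?_ ?_) (hf x))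
      · exact ((le_self_add.trans (hf x)).trans_lt (hvt x).lt_top).ne
      · rw [Ne, ENNReal.ofReal_eq_zero, not_le]
        exact unitInterval.pos_iff_ne_zero.2 hfx

/-! ### Cloud operators -/

/-- The value at `x` of `T_η u` for the marker `η = (x, l)`. -/
noncomputable def pathVal (α : Matrix X X ℝ≥0) (u : X → ℝ≥0∞) : X → List X → ℝ≥0∞
  | x, [] => u x
  | x, y :: l => α x y * pathVal α u y l

theorem proj_singleton_apply (x y : X) [Decidable (x = y)] :
    proj {x} x y = if x = y then 1 else 0 := by
  simp [proj, mulBy]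

theorem act_proj_singleton (x : X) (u : X → ℝ≥0∞) : act (proj {x}) u x = u x := by
  rw [proj, act_mulBy]; simp

theorem act_pathOp (α : Matrix X X ℝ≥0) (u : X → ℝ≥0∞) (x : X) (l : List X) :
    act (pathOp α x l) u x = pathVal α u x l := by
  induction l generalizing x with
  | nil => exact act_proj_singleton x u
  | cons y l ih =>
    rw [pathOp, act_mul, act_mul, act_proj_singleton, act_toOp_apply, tsum_eq_single y, ih]
    · rfl
    · intro z hz
      suffices act (pathOp α y l) u z = 0 by rw [this, mul_zero]
      cases l with
      | nil => rw [pathOp, proj, act_mulBy]; simp [hz]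
      | cons w l => rw [pathOp, act_mul, act_mul, proj, act_mulBy]; simp [hz]

theorem pathOp_apply_eq_zero (α : Matrix X X ℝ≥0) {x z : X} (h : z ≠ x) (l : List X) (y : X) :
    pathOp α x l z y = 0 := by
  classical
  rw [← act_single (pathOp α x l)]
  cases l with
  | nil => rw [pathOp, proj, act_mulBy]; simp [h]
  | cons w l => rw [pathOp, act_mul, act_mul, proj, act_mulBy]; simp [h]

/-- Markers as pairs consisting of the first entry and the remaining ones. -/
def markerEquiv (X : Type*) : Marker X ≃ X × List X where
  toFun η := (η.first, η.rest)
  invFun p := ⟨p.1, p.2⟩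

theorem cloudOp_apply (α : Matrix X X ℝ≥0) (ν : Cloud X) (x y : X) :
    cloudOp α ν x y = ∑' l : List X, ENNReal.ofReal (ν ⟨x, l⟩) * pathOp α x l x y := by
  rw [cloudOp, ← (markerEquiv X).symm.tsum_eq, ENNReal.tsum_prod', tsum_eq_single x]
  · rfl
  · intro z hz
    refine ENNReal.tsum_eq_zero.2 fun l => ?_
    change ENNReal.ofReal (ν ⟨z, l⟩) * pathOp α z l x y = 0
    rw [pathOp_apply_eq_zero α hz.symm, mul_zero]

theorem act_cloudOp (α : Matrix X X ℝ≥0) (ν : Cloud X) (u : X → ℝ≥0∞) (x : X) :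
    act (cloudOp α ν) u x = ∑' l : List X, ENNReal.ofReal (ν ⟨x, l⟩) * pathVal α u x l := by
  simp only [← act_pathOp, act, cloudOp_apply, ← ENNReal.tsum_mul_left, ← ENNReal.tsum_mul_right]
  rw [ENNReal.tsum_comm]
  simp only [mul_assoc]

theorem ofReal_single_le_cloudOp (α : Matrix X X ℝ≥0) (ν : Cloud X) (x : X) :
    ENNReal.ofReal (ν (Marker.single x)) ≤ cloudOp α ν x x := by
  rw [cloudOp_apply]
  refine le_trans (le_of_eq ?_) (ENNReal.le_tsum [])
  classical
  rw [pathOp, proj_singleton_apply]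
  simp [Marker.single]

/-- Lists as the empty list or pairs of a head and a tail. -/
def listEquiv (X : Type*) : Unit ⊕ X × List X ≃ List X where
  toFun o := o.elim (fun _ => []) fun p => p.1 :: p.2
  invFun l := match l with
    | [] => Sum.inl ()
    | x :: l => Sum.inr (x, l)
  left_inv o := by cases o <;> rfl
  right_inv l := by cases l <;> rfl

theorem tsum_list (f : List X → ℝ≥0∞) :
    ∑' l, f l = f [] + ∑' x, ∑' l, f (x :: l) := by
  rw [← (listEquiv X).tsum_eq, Summable.tsum_sum ENNReal.summable ENNReal.summable,
    ENNReal.tsum_prod']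
  simp [listEquiv]

/-- First-step decomposition: a marker either stops at `x` or moves on to some `y`, where the
shifted weights `g (y :: ·)` take over. It drives the inductions on the level below. -/
theorem tsum_pathVal (α : Matrix X X ℝ≥0) (u : X → ℝ≥0∞) (g : List X → ℝ≥0∞) (x : X) :
    ∑' l, g l * pathVal α u x l =
      g [] * u x + ∑' y, α x y * ∑' l, g (y :: l) * pathVal α u y l := by
  rw [tsum_list]
  simp only [pathVal, ← ENNReal.tsum_mul_left]
  congr 1
  refine tsum_congr fun y => tsum_congr fun l => ?_
  ring

theorem sum_take_cons (g : List X → ℝ≥0∞) (y : X) (l : List X) (n : ℕ) :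
    ∑ j ∈ Finset.range (n + 1), g ((y :: l).take j) =
      g [] + ∑ j ∈ Finset.range n, g (y :: l.take j) := by
  rw [Finset.sum_range_succ', add_comm]
  simp

/-- Of a mass `b` at `x`, the part `g []` stays and the rest moves on through `α`, which does not
decrease its value because `u ≤ α u`. The remainder `b - g []` is truncated at zero, as `g []` may
exceed `b`. -/
theorem le_tsum_pathVal {α : Matrix X X ℝ≥0} {u : X → ℝ≥0∞} (hu : u ≤ act (toOp α) u) (N : ℕ)
    (b : ℝ≥0∞) (g : List X → ℝ≥0∞) (x : X)
    (hg : ∀ l : List X, l.length = N → b ≤ ∑ j ∈ Finset.range (N + 1), g (l.take j)) :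
    b * u x ≤ ∑' l, g l * pathVal α u x l := by
  induction N generalizing b g x with
  | zero =>
    rw [tsum_pathVal]
    refine le_trans ?_ le_self_add
    gcongr
    simpa using hg [] rfl
  | succ N ih =>
    rw [tsum_pathVal]
    calc b * u x ≤ (g [] + (b - g [])) * u x := by gcongr; exact le_add_tsub
      _ = g [] * u x + (b - g []) * u x := add_mul _ _ _
      _ ≤ g [] * u x + (b - g []) * act (toOp α) u x := by gcongr; exact hu x
      _ = g [] * u x + ∑' y, α x y * ((b - g []) * u y) := by
        rw [act_toOp_apply, ← ENNReal.tsum_mul_left]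
        congr 1
        exact tsum_congr fun y => by ring
      _ ≤ _ := by
        gcongr with y
        refine ih _ _ _ fun l hl => ?_
        have := hg (y :: l) (by simp [hl])
        rw [sum_take_cons] at this
        exact tsub_le_iff_left.2 this

/-- The reverse bound: at most `b - g []` moves on, and this loses value by `α v ≤ v`. That
inequality is known only on `Λ`, which suffices because no mass moves on from a point outside `Λ`.
-/
theorem tsum_pathVal_le_of_bounded {Λ : Set X} {α : Matrix X X ℝ≥0} {v : X → ℝ≥0∞}
    (hvα : ∀ x ∈ Λ, act (toOp α) v x ≤ v x) (N : ℕ) {b : ℝ≥0∞} (hbt : b ≠ ∞) (g : List X → ℝ≥0∞) (x : X)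
    (hN : ∀ l : List X, N ≤ l.length → g l = 0)
    (hΛ : ∀ l, (∃ y ∈ (x :: l).dropLast, y ∉ Λ) → g l = 0)
    (hg : ∀ l : List X, ∑ j ∈ Finset.range (l.length + 1), g (l.take j) ≤ b) :
    ∑' l, g l * pathVal α v x l ≤ b * v x := by
  induction N generalizing b g x with
  | zero => simp [hN]
  | succ N ih =>
    have hb : g [] ≤ b := by simpa using hg []
    rw [tsum_pathVal]
    by_cases hx : x ∈ Λ
    · calc _ ≤ g [] * v x + ∑' y, α x y * ((b - g []) * v y) := by
            gcongr with y
            refine ih (ENNReal.sub_ne_top hbt) _ _ (fun l hl => hN _ (by simpa using hl)) (fun l hl => hΛ _ ?_)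
              fun l => ?_
            · obtain ⟨z, hz, hz'⟩ := hl
              exact ⟨z, by rw [List.dropLast_cons_cons]; exact List.mem_cons_of_mem _ hz, hz'⟩
            · have := hg (y :: l)
              rw [List.length_cons, sum_take_cons] at this
              exact ENNReal.le_sub_of_add_le_left (ne_top_of_le_ne_top hbt hb) this
        _ = g [] * v x + (b - g []) * act (toOp α) v x := by
            rw [act_toOp_apply, ← ENNReal.tsum_mul_left]
            congr 1
            exact tsum_congr fun y => by ring
        _ ≤ g [] * v x + (b - g []) * v x := by gcongr; exact hvα x hx
        _ = b * v x := by rw [← add_mul, add_tsub_cancel_of_le hb]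
    · have : ∀ y l, g (y :: l) = 0 := fun y l => hΛ _ ⟨x, by simp, hx⟩
      simp only [this, zero_mul, tsum_zero, mul_zero, add_zero]
      gcongr

/-- A finite partial sum sees only lists of bounded length, so `g` may be truncated at that length.
-/
theorem tsum_pathVal_le {Λ : Set X} {α : Matrix X X ℝ≥0} {v : X → ℝ≥0∞}
    (hvα : ∀ x ∈ Λ, act (toOp α) v x ≤ v x) {b : ℝ≥0∞} (hbt : b ≠ ∞) (g : List X → ℝ≥0∞) (x : X)
    (hΛ : ∀ l, (∃ y ∈ (x :: l).dropLast, y ∉ Λ) → g l = 0)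
    (hg : ∀ l : List X, ∑ j ∈ Finset.range (l.length + 1), g (l.take j) ≤ b) :
    ∑' l, g l * pathVal α v x l ≤ b * v x := by
  rw [ENNReal.tsum_eq_iSup_sum]
  refine iSup_le fun s => ?_
  let N := s.sup List.length + 1
  let g' : List X → ℝ≥0∞ := fun l => if l.length < N then g l else 0
  have hle : ∀ l, g' l ≤ g l := fun l => by
    simp only [g']
    split_ifs <;> simp
  have hs : ∀ l ∈ s, g l = g' l := fun l hl =>
    (if_pos (Nat.lt_succ_of_le (Finset.le_sup (f := List.length) hl))).symm
  calc ∑ l ∈ s, g l * pathVal α v x l = ∑ l ∈ s, g' l * pathVal α v x l :=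
        Finset.sum_congr rfl fun l hl => by rw [hs l hl]
    _ ≤ ∑' l, g' l * pathVal α v x l := ENNReal.sum_le_tsum s
    _ ≤ b * v x := tsum_pathVal_le_of_bounded hvα N hbt g' x
        (fun l hl => if_neg (not_lt.2 hl))
        (fun l hl => le_antisymm ((hle l).trans (hΛ l hl).le) zero_le)
        fun l => (Finset.sum_le_sum fun j _ => hle _).trans (hg l)

/-- With `a = ν((x))` and `x ∈ Λ`, at most `1 - a` leaves `x`. The first step costs 1 per unit of
mass since `α v + 1 ≤ v`, and later steps do not increase the value. The first step is therefore
treated separately. -/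
theorem act_cloudOp_add_le {Λ : Finset X} {α : Matrix X X ℝ≥0} {v : X → ℝ≥0∞}
    (hvΛ : ∀ x ∉ Λ, v x = 0) (hv : ∀ x ∈ Λ, act (toOp α) v x + 1 ≤ v x) {ν : Cloud X}
    (h0 : ∀ η, 0 ≤ ν η) (hΛ : ν.CarriedBy Λ) (h1 : ν.norm ≤ 1) (x : X) :
    act (cloudOp α ν) v x +
      ENNReal.ofReal ((Λ : Set X).indicator (fun x => 1 - ν (Marker.single x)) x) ≤ v x := by
  have hc : ∀ l : List X, ∑ j ∈ Finset.range (l.length + 1), ENNReal.ofReal (ν ⟨x, l.take j⟩)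
      ≤ 1 := by
    intro l
    refine le_trans ?_ ((le_iSup _ (⟨x, l⟩ : Marker X)).trans h1)
    rw [Cloud.cum, ← ENNReal.ofReal_sum_of_nonneg fun j _ => h0 _]
    simp only [abs_of_nonneg (h0 _)]
    rfl
  have hx1 : ENNReal.ofReal (ν ⟨x, []⟩) ≤ 1 := by simpa using hc []
  rw [act_cloudOp, tsum_pathVal]
  by_cases hx : x ∈ Λ
  · rw [Set.indicator_of_mem (by simpa using hx), ENNReal.ofReal_sub _ (h0 _), ENNReal.ofReal_one,
      Marker.single]
    set a := ENNReal.ofReal (ν ⟨x, []⟩) with ha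
    calc _ ≤ a * v x + ∑' y, α x y * ((1 - a) * v y) + (1 - a) := by
          gcongr with y
          refine tsum_pathVal_le (Λ := Λ) (fun z hz => le_self_add.trans (hv z (by simpa using hz)))
            (ENNReal.sub_ne_top ENNReal.one_ne_top) (fun l => ENNReal.ofReal (ν ⟨x, y :: l⟩)) y
            (fun l hl => ?_) fun l => ?_
          · obtain ⟨z, hz, hz'⟩ := hl
            rw [hΛ ⟨x, y :: l⟩ ⟨z, ?_, hz'⟩, ENNReal.ofReal_zero]
            rw [Marker.entries, List.dropLast_cons_cons]
            exact List.mem_cons_of_mem _ hz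
          · have := hc (y :: l)
            rw [List.length_cons, sum_take_cons fun l => ENNReal.ofReal (ν ⟨x, l⟩)] at this
            exact ENNReal.le_sub_of_add_le_left ENNReal.ofReal_ne_top this
      _ = a * v x + (1 - a) * (act (toOp α) v x + 1) := by
          rw [mul_add, mul_one, ← add_assoc, act_toOp_apply, ← ENNReal.tsum_mul_left]
          congr 2
          exact tsum_congr fun y => by ring
      _ ≤ a * v x + (1 - a) * v x := by gcongr; exact hv x hx
      _ = v x := by rw [← add_mul, add_tsub_cancel_of_le hx1, one_mul]
  · have : ∀ y l, ν ⟨x, y :: l⟩ = 0 := fun y l =>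
      hΛ _ ⟨x, by simp [Marker.entries], by simpa using hx⟩
    simp [this, hvΛ x hx, hx]

theorem le_act_cloudOp {α : Matrix X X ℝ≥0} {u : X → ℝ≥0∞} (hu : u ≤ act (toOp α) u)
    {ν : Cloud X} (N : ℕ) (h0 : ∀ η, 0 ≤ ν η) (hN : ∀ η : Marker X, η.level = N → 1 ≤ ν.cum η) :
    u ≤ act (cloudOp α ν) u := by
  intro x
  rw [act_cloudOp]
  refine le_trans (by rw [one_mul]) (le_tsum_pathVal hu N 1 _ x fun l hl => ?_)
  rw [← ENNReal.ofReal_sum_of_nonneg fun j _ => h0 _, ENNReal.one_le_ofReal]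
  refine (hN ⟨x, l⟩ hl).trans (le_of_eq ?_)
  rw [Cloud.cum, Marker.level, hl]
  rfl

/-- Beyond level `N` the cumulative mass no longer changes, so the supremum over the descendants of
`η` is attained at `η`. -/
theorem Cloud.MemS.one_le_cum {ν : Cloud X} (h : ν.MemS 1) {N : ℕ}
    (hN : ∀ η : Marker X, N < η.level → ν η = 0) (η : Marker X) (hη : η.level = N) :
    1 ≤ ν.cum η := by
  have h1 := h.2 η
  rw [ENNReal.ofReal_one] at h1
  rw [← ENNReal.one_le_ofReal, ← h1]
  refine iSup_le fun ⟨η', j, hj, hσ⟩ => ENNReal.ofReal_le_ofReal (le_of_eq ?_)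
  have hjN : j = N := by
    rw [← hη, hσ]
    simpa [Marker.level, Marker.upTo] using hj
  subst hjN
  rw [Cloud.cum, Cloud.cum, hη]
  have hsub : Finset.range (j + 1) ⊆ Finset.range (η'.level + 1) :=
    Finset.range_subset_range.2 (by omega)
  rw [← Finset.sum_subset hsub]
  · refine Finset.sum_congr rfl fun i hi => ?_
    have hi' : η.upTo i = η'.upTo i := by
      rw [hσ, Marker.upTo, Marker.upTo, Marker.upTo, List.take_take,
        min_eq_left (by simpa [Nat.lt_succ_iff] using hi)]
    exact congrArg ν hi'.symm
  · intro i hi hi'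
    refine hN _ ?_
    simp only [Finset.mem_range, Marker.level] at hi hi'
    simp only [Marker.level, Marker.upTo, List.length_take]
    omega

/-! ### The cloud of level one -/

open Classical in
/-- The cloud of mass one on the markers `(x)` with `x ∉ Λ` and `(x, y)` with `x ∈ Λ`. -/
noncomputable def stepCloud (Λ : Set X) : Cloud X := fun η =>
  match η with
  | ⟨x, []⟩ => if x ∈ Λ then 0 else 1
  | ⟨x, [_]⟩ => if x ∈ Λ then 1 else 0
  | ⟨_, _ :: _ :: _⟩ => 0

theorem stepCloud_nonneg (Λ : Set X) (η : Marker X) : 0 ≤ stepCloud Λ η := by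
  unfold stepCloud
  split <;> (try split_ifs) <;> norm_num

theorem stepCloud_single {Λ : Set X} {x : X} (hx : x ∈ Λ) :
    stepCloud Λ (Marker.single x) = 0 := by
  simp [stepCloud, Marker.single, hx]

theorem stepCloud_eq_zero (Λ : Set X) (η : Marker X) (h : 1 < η.level) : stepCloud Λ η = 0 := by
  obtain ⟨x, l⟩ := η
  match l with
  | [] => simp [Marker.level] at h
  | [y] => simp [Marker.level] at h
  | y :: z :: l => rfl

theorem carriedBy_stepCloud (Λ : Set X) : (stepCloud Λ).CarriedBy Λ := by
  rintro ⟨x, l⟩ ⟨z, hz, hz'⟩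
  match l with
  | [] => simp [Marker.entries] at hz
  | [y] =>
    simp only [Marker.entries, List.dropLast_cons_cons, List.dropLast_singleton,
      List.mem_singleton] at hz
    subst hz
    simp [stepCloud, hz']
  | y :: w :: l => rfl

theorem cum_stepCloud_cons (Λ : Set X) (x y : X) (l : List X) :
    (stepCloud Λ).cum ⟨x, y :: l⟩ = 1 := by
  rw [Cloud.cum, Marker.level, List.length_cons, Finset.sum_range_succ', Finset.sum_range_succ',
    Finset.sum_eq_zero fun j hj => ?_]
  · by_cases hx : x ∈ Λ <;> simp [Marker.upTo, stepCloud, hx]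
  · refine stepCloud_eq_zero Λ _ ?_
    simp only [Finset.mem_range] at hj
    simp only [Marker.level, Marker.upTo, List.length_take, List.length_cons]
    omega

theorem cum_stepCloud_le (Λ : Set X) (η : Marker X) : (stepCloud Λ).cum η ≤ 1 := by
  obtain ⟨x, _ | ⟨y, l⟩⟩ := η
  · by_cases hx : x ∈ Λ <;> simp [Cloud.cum, Marker.level, Marker.upTo, stepCloud, hx]
  · exact (cum_stepCloud_cons Λ x y l).le

theorem norm_stepCloud_le (Λ : Set X) : (stepCloud Λ).norm ≤ 1 := by
  refine iSup_le fun η => ?_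
  simp only [abs_of_nonneg (stepCloud_nonneg Λ _)]
  exact ENNReal.ofReal_le_one.2 (cum_stepCloud_le Λ η)

theorem memS_stepCloud (Λ : Set X) : (stepCloud Λ).MemS 1 := by
  refine ⟨stepCloud_nonneg Λ, fun η => le_antisymm
    (iSup_le fun η' => ENNReal.ofReal_le_ofReal (cum_stepCloud_le Λ _)) ?_⟩
  obtain ⟨x, l⟩ := η
  -- Appending any letter gives a descendant of level at least 1, where the cumulative mass is
  -- exactly 1.
  have hanc : Marker.IsAncestor ⟨x, l⟩ ⟨x, l ++ [x]⟩ :=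
    ⟨l.length, by simp [Marker.level], by simp [Marker.upTo]⟩
  refine le_trans (ENNReal.ofReal_le_ofReal (le_of_eq ?_))
    (le_iSup (fun η' : {η' : Marker X // Marker.IsAncestor ⟨x, l⟩ η'} =>
      ENNReal.ofReal ((stepCloud Λ).cum η'.1)) ⟨_, hanc⟩)
  cases l <;> exact (cum_stepCloud_cons Λ x _ _).symm

/-- The indicator function of `Λ` with values in the unit interval. -/
noncomputable def unitIndicator (Λ : Set X) : X → unitInterval := Λ.indicator 1

theorem support_unitIndicator (Λ : Set X) : Function.support (unitIndicator Λ) = Λ := by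
  simp [unitIndicator]

theorem tendsto_sum_const_one : Tendsto (fun n => ∑ _i ∈ Finset.range n, (1 : ℝ)) atTop atTop := by
  simpa using tendsto_natCast_atTop_atTop (R := ℝ)

end

/-! ### The implications between (a) and the other conditions -/

section

variable {X : Type*} {Λ : Finset X} {α : Matrix X X ℝ≥0}

theorem spr_cloudOp_lt_one (h : spr Λ (toOp α) < 1) {ν : Cloud X} (h0 : ∀ η, 0 ≤ ν η)
    (hΛ : ν.CarriedBy Λ) (h1 : ν.norm ≤ 1) (hlt : ∀ x ∈ Λ, ν (Marker.single x) < 1) :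
    spr Λ (cloudOp α ν) < 1 := by
  obtain ⟨v, hvΛ, hvt, -, hv⟩ := exists_superharmonic_of_spr_lt_one h
  refine spr_lt_one_of_superharmonic hvt fun x hx => ?_
  have h2 := act_cloudOp_add_le hvΛ hv h0 hΛ h1 x
  refine lt_of_lt_of_le (ENNReal.lt_add_right ?_ ?_) h2
  · exact ((le_self_add.trans h2).trans_lt (hvt x).lt_top).ne
  · rw [Set.indicator_of_mem (by simpa using hx), Ne, ENNReal.ofReal_eq_zero, not_le]
    linarith [hlt x hx]

theorem spr_prod_clean_lt_one (h : spr Λ (toOp α) < 1) {l : List (X → unitInterval)}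
    (hl : ∀ f ∈ l, Function.support f ⊆ Λ) (hpos : ∀ x ∈ Λ, ∃ f ∈ l, f x ≠ 0) :
    spr Λ (prod (l.map (clean α))) < 1 := by
  obtain ⟨v, -, hvt, -, hv⟩ := exists_superharmonic_of_spr_lt_one h
  exact spr_lt_one_of_superharmonic hvt fun x hx => (act_prod_clean_lt hvt hv hl).2 x (hpos x hx)

theorem spr_toOp_lt_one_of_prod_clean {l : List (X → unitInterval)}
    (h : spr Λ (prod (l.map (clean α))) < 1) : spr Λ (toOp α) < 1 :=
  spr_toOp_lt_one_of_spr_lt_one (fun _ _ hu => le_act_prod fun T hT => by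
    obtain ⟨f, -, rfl⟩ := List.mem_map.1 hT
    exact le_act_clean f hu) h

theorem prod_singleton (A : Operator X) : prod [A] = A := by
  classical
  funext x y
  rw [← act_single (prod [A]), prod, act_mul, prod, act_univ, act_single]

theorem support_sum_coe {m : ℕ} (f : Fin m → X → unitInterval)
    (h : Function.support (fun x => ∑ i, (f i x : ℝ)) = Λ) :
    (∀ i, Function.support (f i) ⊆ Λ) ∧ ∀ x ∈ Λ, ∃ i, f i x ≠ 0 := by
  have hiff : ∀ x, x ∈ Λ ↔ ∃ i, f i x ≠ 0 := by
    intro x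
    rw [← Finset.mem_coe, ← h, Function.mem_support, Ne,
      Finset.sum_eq_zero_iff_of_nonneg fun i _ => (f i x).2.1]
    simp
  exact ⟨fun i x hx => (hiff x).2 ⟨i, hx⟩, fun x hx => (hiff x).1 hx⟩

theorem tendsto_prod_clean (h : spr Λ (toOp α) < 1) {f : ℕ → X → unitInterval}
    (hf : ∀ i, Function.support (f i) ⊆ Λ)
    (hdiv : ∀ x ∈ Λ, Tendsto (fun n => ∑ i ∈ Finset.range n, (f i x : ℝ)) atTop atTop) :
    Tendsto (fun n => sandwich Λ (prod ((List.range n).map fun i => clean α (f i))))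
      atTop (𝓝 0) := by
  obtain ⟨v, -, hvt, hv1, hv⟩ := exists_superharmonic_of_spr_lt_one h
  exact tendsto_sandwich_prod_zero (d := fun i x => (f i x : ℝ)) hvt hv1
    (fun i x => (f i x).2.1) (fun i x _ => (f i x).2.2) (fun i x => act_clean_add_le (hf i) hv x)
    (fun i x _ => ofReal_one_sub_le_clean α (f i) x) hdiv

theorem Cloud.le_one_of_norm_le {ν : Cloud X} (h1 : ν.norm ≤ 1) (x : X) :
    ν (Marker.single x) ≤ 1 := by
  have := (le_iSup _ (Marker.single x)).trans h1
  rw [ENNReal.ofReal_le_one, Cloud.cum] at this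
  exact (le_abs_self _).trans (by simpa [Marker.single, Marker.level, Marker.upTo] using this)

theorem tendsto_prod_cloudOp (h : spr Λ (toOp α) < 1) {ν : ℕ → Cloud X}
    (hν : ∀ i, (∀ η, 0 ≤ ν i η) ∧ (ν i).CarriedBy Λ ∧ (ν i).norm ≤ 1)
    (hdiv : ∀ x ∈ Λ, Tendsto (fun n => ∑ i ∈ Finset.range n, (1 - ν i (Marker.single x)))
      atTop atTop) :
    Tendsto (fun n => sandwich Λ (prod ((List.range n).map fun i => cloudOp α (ν i))))
      atTop (𝓝 0) := by
  obtain ⟨v, hvΛ, hvt, hv1, hv⟩ := exists_superharmonic_of_spr_lt_one h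
  have hd : ∀ i, ∀ x ∈ Λ, (Λ : Set X).indicator (fun x => 1 - ν i (Marker.single x)) x =
      1 - ν i (Marker.single x) := fun i x hx => Set.indicator_of_mem (by simpa using hx) _
  refine tendsto_sandwich_prod_zero
    (d := fun i => (Λ : Set X).indicator fun x => 1 - ν i (Marker.single x)) hvt hv1
    (fun i x => Set.indicator_nonneg (fun x _ => ?_) x) (fun i x hx => ?_)
    (fun i x => act_cloudOp_add_le hvΛ hv (hν i).1 (hν i).2.1 (hν i).2.2 x)
    (fun i x hx => ?_) (fun x hx => ?_)
  · exact sub_nonneg.2 (Cloud.le_one_of_norm_le (hν i).2.2 x)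
  · rw [hd i x hx]
    linarith [(hν i).1 (Marker.single x)]
  · rw [hd i x hx, sub_sub_cancel]
    exact ofReal_single_le_cloudOp α (ν i) x
  · simpa only [hd _ x hx] using hdiv x hx

end

end Balayage

open Balayage
theorem mainTheorem5 {X : Type*} [Countable X] [Nonempty X] (Λ : Finset X)
    (α : Matrix X X ℝ≥0) :
    List.TFAE [
      -- (a)
      spr Λ (sandwich Λ (toOp α)) < 1,
      -- (b)
      ∀ h : X → unitInterval, Function.support h = Λ →
        spr Λ (sandwich Λ (clean α h)) < 1,
      -- (b')
      ∃ h : X → unitInterval, Function.support h ⊆ Λ ∧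
        spr Λ (sandwich Λ (clean α h)) < 1,
      -- (c)
      ∀ (m : ℕ) (f : Fin m → X → unitInterval),
        Function.support (fun x => ∑ i, (f i x : ℝ)) = Λ →
        spr Λ (sandwich Λ (Balayage.prod (List.ofFn fun i => clean α (f i)))) < 1,
      -- (c')
      ∃ (m : ℕ) (f : Fin m → X → unitInterval),
        (∀ i, Function.support (f i) ⊆ Λ) ∧
        spr Λ (sandwich Λ (Balayage.prod (List.ofFn fun i => clean α (f i)))) < 1,
      -- (d)
      ∀ ν : Cloud X, (∀ η, 0 ≤ ν η) → ν.CarriedBy Λ → ν.norm ≤ 1 →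
        (∀ x ∈ Λ, ν (Marker.single x) < 1) →
        spr Λ (sandwich Λ (cloudOp α ν)) < 1,
      -- (d')
      ∃ ν : Cloud X, ν.MemS 1 ∧ ν.CarriedBy Λ ∧ ν.FiniteLevels ∧
        spr Λ (sandwich Λ (cloudOp α ν)) < 1,
      -- (e)
      ∀ f : ℕ → X → unitInterval, (∀ i, Function.support (f i) ⊆ Λ) →
        (∀ x ∈ Λ, Tendsto (fun n => ∑ i ∈ Finset.range n, (f i x : ℝ)) atTop atTop) →
        Tendsto (fun n => sandwich Λ (Balayage.prod ((List.range n).map fun i => clean α (f i))))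
          atTop (𝓝 0),
      -- (f)
      ∀ ν : ℕ → Cloud X,
        (∀ i, (∀ η, 0 ≤ ν i η) ∧ (ν i).CarriedBy Λ ∧ (ν i).norm ≤ 1) →
        (∀ x ∈ Λ, Tendsto (fun n => ∑ i ∈ Finset.range n, (1 - ν i (Marker.single x)))
          atTop atTop) →
        Tendsto (fun n => sandwich Λ (Balayage.prod ((List.range n).map fun i => cloudOp α (ν i))))
          atTop (𝓝 0)
    ] := by
  simp only [spr_sandwich]
  have hmap : ∀ {m : ℕ} (f : Fin m → X → unitInterval),
      (List.ofFn fun i => clean α (f i)) = (List.ofFn f).map (clean α) := fun f => by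
    rw [List.map_ofFn]; rfl
  tfae_have 1 → 4 := fun h m f hf => by
    obtain ⟨h1, h2⟩ := support_sum_coe f hf
    rw [hmap]
    refine spr_prod_clean_lt_one h (fun g hg => ?_) fun x hx => ?_
    · obtain ⟨i, rfl⟩ := (List.mem_ofFn' f g).1 hg
      exact h1 i
    · obtain ⟨i, hi⟩ := h2 x hx
      exact ⟨f i, (List.mem_ofFn' f _).2 ⟨i, rfl⟩, hi⟩
  tfae_have 4 → 2 := fun h f hf => by
    have := h 1 (fun _ => f) (by rw [← hf]; ext x; simp)
    simpa [prod_singleton] using this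
  tfae_have 2 → 3 := fun h =>
    ⟨_, (support_unitIndicator _).subset, h _ (support_unitIndicator _)⟩
  tfae_have 3 → 5 := fun ⟨f, hf, h⟩ => ⟨1, fun _ => f, fun _ => hf, by simpa [prod_singleton]⟩
  tfae_have 5 → 1 := fun ⟨m, f, _, h⟩ => by
    rw [hmap] at h
    exact spr_toOp_lt_one_of_prod_clean h
  tfae_have 1 → 6 := fun h ν h0 hΛ h1 hlt => spr_cloudOp_lt_one h h0 hΛ h1 hlt
  tfae_have 6 → 7 := fun h => ⟨stepCloud Λ, memS_stepCloud _, carriedBy_stepCloud _,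
    ⟨1, stepCloud_eq_zero _⟩, h _ (stepCloud_nonneg _) (carriedBy_stepCloud _)
      (norm_stepCloud_le _) fun x hx => by
        rw [stepCloud_single (by simpa using hx)]; exact one_pos⟩
  tfae_have 7 → 1 := fun ⟨ν, hν, _, ⟨N, hN⟩, h⟩ =>
    spr_toOp_lt_one_of_spr_lt_one
      (fun u _ hu => le_act_cloudOp hu N hν.1 (hν.one_le_cum hN)) h
  tfae_have 1 → 8 := fun h f hf hdiv => tendsto_prod_clean h hf hdiv
  -- A constant sequence suffices: the partial sums of the indicator at a point of `Λ` are `n`.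
  tfae_have 8 → 1 := fun h =>
    spr_toOp_lt_one_of_tendsto (T := fun _ => clean α (unitIndicator Λ))
      (fun _ u _ hu => le_act_clean _ hu)
      (h (fun _ => unitIndicator Λ) (fun _ => (support_unitIndicator _).subset) fun x hx => by
        simpa [unitIndicator, hx] using tendsto_sum_const_one)
  tfae_have 1 → 9 := fun h ν hν hdiv => tendsto_prod_cloudOp h hν hdiv
  -- Again a constant sequence: `stepCloud` has no mass on `(x)` for `x ∈ Λ`, so each term of the
  -- divergent sum is 1.
  tfae_have 9 → 1 := fun h =>
    spr_toOp_lt_one_of_tendsto (T := fun _ => cloudOp α (stepCloud Λ))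
      (fun _ u _ hu => le_act_cloudOp hu 1 (stepCloud_nonneg _)
        ((memS_stepCloud _).one_le_cum (stepCloud_eq_zero _)))
      (h (fun _ => stepCloud Λ)
        (fun _ => ⟨stepCloud_nonneg _, carriedBy_stepCloud _, norm_stepCloud_le _⟩)
        fun x hx => by
          simpa [stepCloud_single (Λ := (Λ : Set X)) (x := x) (by simpa using hx)]
            using tendsto_sum_const_one)
  tfae_finish
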